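/- Let $\mathbb S^2\subset\mathbb R^3$ be the unit sphere with geodesic distance $d(\xi,\eta)=\arccos\langle\xi,\eta\rangle$ and surface measure $dx$, and let $B>1$. For every integer $j\ge 0$ let $\mathcal Z_j=\{\xi_{j,1},\dots,\xi_{j,n_j}\}\subset\mathbb S^2$ be a finite set of $n_j$ distinct cubature points of scale $j$: there are an integer $L_j\ge 0$ and weights $\lambda_{j,k}>0$ such that $\int_{\mathbb S^2}f(x)\,dx=\sum_{k}\lambda_{j,k}f(\xi_{j,k})$ for every restriction $f$ to $\mathbb S^2$ of a polynomial of degree at most $L_j$, and $\mathcal Z_j$ is a maximal $\varepsilon_j$-mesh with $\varepsilon_j\sim B^{-j}$, that is, $d(\xi,\eta)>\varepsilon_j$ for all distinct $\xi,\eta\in\mathcal Z_j$, no point of $\mathbb S^2$ can be added to $\mathcal Z_j$ without destroying this property, and $c_1B^{-j}\le\varepsilon_j\le c_2B^{-j}$ with constants $c_1,c_2>0$ independent of $j$. Then for every real $M\ge 3$ there is a constant $C'_M$, depending only on $M$, $B$, $c_1$ and $c_2$ (in particular not on $j$ and $k$), such that for all $j\ge 0$ and all $k\in\{1,\dots,n_j\}$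 $$\sum_{k'=1}^{n_j}\frac{1}{\bigl(1+B^j d(\xi_{j,k},\xi_{j,k'})\bigr)^M}\le C'_M .$$ -/

import Mathlib

open MeasureTheory

/-- The unit sphere `𝕊²` of Euclidean three-space. -/
abbrev UnitSphere : Type := Metric.sphere (0 : EuclideanSpace ℝ (Fin 3)) 1

/-- The geodesic distance `d(ξ, η) = arccos ⟨ξ, η⟩` on the sphere. (The metric that `UnitSphere`
inherits as a subtype is the chordal one.) -/
noncomputable def geodesicDist (ξ η : UnitSphere) : ℝ :=
  Real.arccos (inner ℝ (ξ : EuclideanSpace ℝ (Fin 3)) (η : EuclideanSpace ℝ (Fin 3)))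

/-- The surface measure `dx` on the sphere, of total mass `4π`. -/
noncomputable def surfaceMeasure : Measure UnitSphere :=
  (volume : Measure (EuclideanSpace ℝ (Fin 3))).toSphere

/-- The restriction to the sphere of a polynomial in three variables. -/
noncomputable def spherePoly (p : MvPolynomial (Fin 3) ℝ) (x : UnitSphere) : ℝ :=
  MvPolynomial.eval (fun i => (x : EuclideanSpace ℝ (Fin 3)) i) p

/-- `Z` is a set of cubature points with positive weights `w`, exact on the space
of restrictions to the sphere of polynomials of degree at most `l`. -/
structure IsCubature (l : ℕ) (Z : Finset UnitSphere) (w : UnitSphere → ℝ) : Prop where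
  weight_pos : ∀ η ∈ Z, 0 < w η
  integral_eq : ∀ p : MvPolynomial (Fin 3) ℝ, p.totalDegree ≤ l →
    ∫ x, spherePoly p x ∂surfaceMeasure = ∑ η ∈ Z, w η * spherePoly p η

/-- An `ε`-mesh: distinct points are at geodesic distance more than `ε`. -/
def IsMesh (ε : ℝ) (S : Set UnitSphere) : Prop :=
  S.Pairwise fun ξ η => ε < geodesicDist ξ η

/-- A maximal `ε`-mesh: no further point of the sphere can be added to it. -/
def IsMaximalMesh (ε : ℝ) (S : Set UnitSphere) : Prop :=
  Maximal (IsMesh ε) S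

/-! Six pieces, on each of which some `±xᵢ ≥ 1/2`, cover the sphere, and projection along the `i`-th
axis is bi-Lipschitz on each. Projected mesh points of one piece therefore lie in distinct cells of
a planar grid of side comparable to `B^{-j}`. Counting cells from that of `ξ` dominates the sum by a
multiple of `∑ (1 + ‖m‖)^{-M}` over `ℤ²`, which converges for `M > 2`. Only `B^j d` enters, so the
bound does not depend on `j`. -/

/-- A point of the sphere has a coordinate of absolute value at least `1 / 2`. -/
theorem exists_half_le_unit_mul_coord (x : UnitSphere) :
    ∃ q : Fin 3 × ℤˣ, 1 / 2 ≤ ((q.2 : ℤ) : ℝ) * (x : EuclideanSpace ℝ (Fin 3)) q.1 := by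
  have hx : ‖(x : EuclideanSpace ℝ (Fin 3))‖ = 1 := norm_eq_of_mem_sphere x
  have hsq := EuclideanSpace.real_norm_sq_eq (x : EuclideanSpace ℝ (Fin 3))
  rw [hx, Fin.sum_univ_three] at hsq
  by_contra! h
  have hbound : ∀ i, (x : EuclideanSpace ℝ (Fin 3)) i ^ 2 < 1 / 4 := by
    intro i
    have h₁ := h (i, 1)
    have h₂ := h (i, -1)
    push_cast at h₁ h₂
    nlinarith
  linarith [hbound 0, hbound 1, hbound 2]

theorem cos_geodesicDist (x y : UnitSphere) :
    Real.cos (geodesicDist x y) =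
      1 - dist (x : EuclideanSpace ℝ (Fin 3)) (y : EuclideanSpace ℝ (Fin 3)) ^ 2 / 2 := by
  have hx : ‖(x : EuclideanSpace ℝ (Fin 3))‖ = 1 := norm_eq_of_mem_sphere x
  have hy : ‖(y : EuclideanSpace ℝ (Fin 3))‖ = 1 := norm_eq_of_mem_sphere y
  have habs := abs_real_inner_le_norm (x : EuclideanSpace ℝ (Fin 3)) (y : EuclideanSpace ℝ (Fin 3))
  rw [hx, hy, mul_one, abs_le] at habs
  rw [geodesicDist, Real.cos_arccos habs.1 habs.2, dist_eq_norm, norm_sub_sq_real, hx, hy]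
  ring

theorem geodesicDist_nonneg (x y : UnitSphere) : 0 ≤ geodesicDist x y :=
  Real.arccos_nonneg _

/-- The chordal distance is at most the geodesic distance. -/
theorem dist_le_geodesicDist (x y : UnitSphere) :
    dist (x : EuclideanSpace ℝ (Fin 3)) (y : EuclideanSpace ℝ (Fin 3)) ≤ geodesicDist x y := by
  have h := Real.one_sub_sq_div_two_le_cos (x := geodesicDist x y)
  rw [cos_geodesicDist] at h
  exact le_of_sq_le_sq (by linarith) (geodesicDist_nonneg x y)

/-- The geodesic distance is at most twice the chordal distance. -/
theorem geodesicDist_le_two_mul_dist (x y : UnitSphere) :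
    geodesicDist x y ≤
      2 * dist (x : EuclideanSpace ℝ (Fin 3)) (y : EuclideanSpace ℝ (Fin 3)) := by
  have hle : |geodesicDist x y| ≤ Real.pi := by
    rw [abs_of_nonneg (geodesicDist_nonneg x y)]
    exact Real.arccos_le_pi _
  have h := Real.cos_le_one_sub_mul_cos_sq hle
  rw [cos_geodesicDist] at h
  -- From `π < 4`; it turns `cos t ≤ 1 - 2t²/π²` into `t² ≤ 4 dist²`.
  have hpi : 1 / 8 ≤ 2 / Real.pi ^ 2 := by
    rw [div_le_div_iff₀ (by norm_num) (by positivity)]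
    nlinarith [Real.pi_lt_four, Real.pi_pos]
  have hmul := mul_le_mul_of_nonneg_right hpi (sq_nonneg (geodesicDist x y))
  refine le_of_sq_le_sq ?_ (by positivity)
  nlinarith

/-- Where the `i`-th coordinate stays away from zero, with a fixed sign, the projection of the sphere
along the `i`-th axis is bi-Lipschitz. -/
theorem dist_le_of_coord_le {x y : UnitSphere} {i : Fin 3} {u : ℤˣ} {s : ℝ} (hs : 0 ≤ s)
    (hx : 1 / 2 ≤ ((u : ℤ) : ℝ) * (x : EuclideanSpace ℝ (Fin 3)) i)
    (hy : 1 / 2 ≤ ((u : ℤ) : ℝ) * (y : EuclideanSpace ℝ (Fin 3)) i)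
    (h : ∀ a : Fin 2, |(x : EuclideanSpace ℝ (Fin 3)) (i.succAbove a) -
      (y : EuclideanSpace ℝ (Fin 3)) (i.succAbove a)| ≤ s) :
    dist (x : EuclideanSpace ℝ (Fin 3)) (y : EuclideanSpace ℝ (Fin 3)) ≤ 5 * s := by
  have hx₁ : ‖(x : EuclideanSpace ℝ (Fin 3))‖ = 1 := norm_eq_of_mem_sphere x
  have hy₁ : ‖(y : EuclideanSpace ℝ (Fin 3))‖ = 1 := norm_eq_of_mem_sphere y
  have hxsq := EuclideanSpace.real_norm_sq_eq (x : EuclideanSpace ℝ (Fin 3))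
  have hysq := EuclideanSpace.real_norm_sq_eq (y : EuclideanSpace ℝ (Fin 3))
  have hxysq := EuclideanSpace.real_norm_sq_eq
    ((x : EuclideanSpace ℝ (Fin 3)) - (y : EuclideanSpace ℝ (Fin 3)))
  have hxa := fun a => (PiLp.norm_apply_le (x : EuclideanSpace ℝ (Fin 3)) a).trans_eq hx₁
  have hya := fun a => (PiLp.norm_apply_le (y : EuclideanSpace ℝ (Fin 3)) a).trans_eq hy₁
  rw [hx₁, Fin.sum_univ_succAbove _ i, Fin.sum_univ_two] at hxsq
  rw [hy₁, Fin.sum_univ_succAbove _ i, Fin.sum_univ_two] at hysq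
  rw [Fin.sum_univ_succAbove _ i, Fin.sum_univ_two, ← dist_eq_norm] at hxysq
  simp only [PiLp.sub_apply] at hxysq
  have hdiff : ∀ a : Fin 2, |(x : EuclideanSpace ℝ (Fin 3)) (i.succAbove a) ^ 2 -
      (y : EuclideanSpace ℝ (Fin 3)) (i.succAbove a) ^ 2| ≤ 2 * s := by
    intro a
    have hadd : |(x : EuclideanSpace ℝ (Fin 3)) (i.succAbove a) +
        (y : EuclideanSpace ℝ (Fin 3)) (i.succAbove a)| ≤ 2 :=
      (abs_add_le _ _).trans ((add_le_add (hxa _) (hya _)).trans_eq one_add_one_eq_two)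
    rw [sq_sub_sq, abs_mul]
    exact mul_le_mul hadd (h a) (abs_nonneg _) zero_le_two
  have hsum : 1 ≤ |(x : EuclideanSpace ℝ (Fin 3)) i + (y : EuclideanSpace ℝ (Fin 3)) i| := by
    rcases Int.units_eq_one_or u with rfl | rfl <;> push_cast at hx hy
    · exact le_abs.2 (Or.inl (by linarith))
    · exact le_abs.2 (Or.inr (by linarith))
  -- Both norms are 1, so `xᵢ² - yᵢ²` is minus the sum of the other two differences of squares;
  -- `hsum` allows division by `xᵢ + yᵢ`.
  have hi : |(x : EuclideanSpace ℝ (Fin 3)) i - (y : EuclideanSpace ℝ (Fin 3)) i| ≤ 4 * s := by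
    refine (le_mul_of_one_le_left (abs_nonneg _) hsum).trans ?_
    rw [← abs_mul, ← sq_sub_sq]
    have h₀ := abs_le.1 (hdiff 0)
    have h₁ := abs_le.1 (hdiff 1)
    exact abs_le.2 ⟨by linarith, by linarith⟩
  have hi₂ := sq_le_sq' (abs_le.1 hi).1 (abs_le.1 hi).2
  have h₀ := sq_le_sq' (abs_le.1 (h 0)).1 (abs_le.1 (h 0)).2
  have h₁ := sq_le_sq' (abs_le.1 (h 1)).1 (abs_le.1 (h 1)).2
  -- `16 + 1 + 1 ≤ 25`.
  refine le_of_sq_le_sq ?_ (by positivity)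
  nlinarith [sq_nonneg s]

theorem summable_one_add_norm_rpow_neg {M : ℝ} (hM : 2 < M) :
    Summable fun m : Fin 2 → ℤ => (1 + ‖m‖) ^ (-M) := by
  refine (EisensteinSeries.summable_one_div_norm_rpow hM).of_norm_bounded_eventually ?_
  -- At `m = 0` the comparison fails, since `0 ^ (-M) = 0`.
  refine (Set.finite_singleton (0 : Fin 2 → ℤ)).subset fun m hm => ?_
  by_contra hne
  refine hm ?_
  have hpos : 0 < ‖m‖ := norm_pos_iff.2 hne
  rw [Set.mem_ofPred_eq, Real.norm_of_nonneg (by positivity)]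
  exact Real.rpow_le_rpow_of_nonpos hpos (by linarith) (by linarith)

/-- Rounding to a grid of side `s` increases distances by at most one grid step. -/
theorem abs_floor_div_sub_floor_div_le {s d a b : ℝ} (hs : 0 < s) (h : |a - b| ≤ d) :
    |((⌊a / s⌋ - ⌊b / s⌋ : ℤ) : ℝ)| ≤ d / s + 1 := by
  have hd : |a / s - b / s| ≤ d / s := by
    rw [← sub_div, abs_div, abs_of_pos hs]
    gcongr
  push_cast
  have := abs_le.1 hd
  exact abs_le.2 ⟨by linarith [Int.floor_le (b / s), Int.lt_floor_add_one (a / s)],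
    by linarith [Int.floor_le (a / s), Int.lt_floor_add_one (b / s)]⟩

/-- The lattice cell, relative to that of `ξ`, of the projection of `x` along the `i`-th axis. -/
noncomputable def relativeCell (s : ℝ) (i : Fin 3) (ξ x : UnitSphere) (a : Fin 2) : ℤ :=
  ⌊(x : EuclideanSpace ℝ (Fin 3)) (i.succAbove a) / s⌋ -
    ⌊(ξ : EuclideanSpace ℝ (Fin 3)) (i.succAbove a) / s⌋

theorem norm_relativeCell_le {s : ℝ} (hs : 0 < s) (i : Fin 3) (ξ x : UnitSphere) :
    ‖relativeCell s i ξ x‖ ≤ geodesicDist ξ x / s + 1 := by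
  have hd := geodesicDist_nonneg ξ x
  refine (pi_norm_le_iff_of_nonneg (by positivity)).2 fun a => ?_
  rw [Int.norm_eq_abs]
  refine abs_floor_div_sub_floor_div_le hs (le_trans ?_ (dist_le_geodesicDist ξ x))
  rw [dist_comm, dist_eq_norm]
  exact PiLp.norm_apply_le
    ((x : EuclideanSpace ℝ (Fin 3)) - (ξ : EuclideanSpace ℝ (Fin 3))) (i.succAbove a)

theorem dist_le_of_relativeCell_eq {s : ℝ} (hs : 0 < s) {i : Fin 3} {u : ℤˣ} {ξ x y : UnitSphere}
    (hx : 1 / 2 ≤ ((u : ℤ) : ℝ) * (x : EuclideanSpace ℝ (Fin 3)) i)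
    (hy : 1 / 2 ≤ ((u : ℤ) : ℝ) * (y : EuclideanSpace ℝ (Fin 3)) i)
    (h : relativeCell s i ξ x = relativeCell s i ξ y) :
    dist (x : EuclideanSpace ℝ (Fin 3)) (y : EuclideanSpace ℝ (Fin 3)) ≤ 5 * s := by
  refine dist_le_of_coord_le hs.le hx hy fun a => ?_
  have hlt := Int.abs_sub_lt_one_of_floor_eq_floor (sub_left_injective (congrFun h a))
  rw [← sub_div, abs_div, abs_of_pos hs, div_lt_one hs] at hlt
  exact hlt.le

/-- The part of the sum over points of an `ε`-mesh lying in a piece of the sphere on which one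
coordinate stays away from zero, with a fixed sign, is bounded by a lattice sum. -/
theorem sum_le_tsum_of_isMesh {M b c ε : ℝ} (hM : 2 < M) (hb : 0 < b) (hc : 0 < c)
    (hε : c / b ≤ ε) {S : Finset UnitSphere} (hS : IsMesh ε (S : Set UnitSphere))
    {i : Fin 3} {u : ℤˣ} (hi : ∀ x ∈ S, 1 / 2 ≤ ((u : ℤ) : ℝ) * (x : EuclideanSpace ℝ (Fin 3)) i)
    (ξ : UnitSphere) :
    ∑ x ∈ S, 1 / (1 + b * geodesicDist ξ x) ^ M ≤
      (2 + 10 / c) ^ M * ∑' m : Fin 2 → ℤ, (1 + ‖m‖) ^ (-M) := by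
  -- With this side `s`, points sharing a cell are at chordal distance at most `5s`, hence geodesic
  -- distance at most `10s = c / b ≤ ε`.
  have hs : 0 < c / (10 * b) := by positivity
  have hinj : Set.InjOn (relativeCell (c / (10 * b)) i ξ) (S : Set UnitSphere) := by
    intro x hx y hy hxy
    by_contra hne
    have hlt : ε < geodesicDist x y := hS hx hy hne
    have hle := dist_le_of_relativeCell_eq hs (hi x hx) (hi y hy) hxy
    have heq : 2 * (5 * (c / (10 * b))) = c / b := by field_simp; norm_num
    linarith [geodesicDist_le_two_mul_dist x y]
  have hterm : ∀ x ∈ S, 1 / (1 + b * geodesicDist ξ x) ^ M ≤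
      (2 + 10 / c) ^ M * (1 + ‖relativeCell (c / (10 * b)) i ξ x‖) ^ (-M) := by
    intro x _
    have hd := geodesicDist_nonneg ξ x
    have hle : 1 + ‖relativeCell (c / (10 * b)) i ξ x‖ ≤
        (2 + 10 / c) * (1 + b * geodesicDist ξ x) := by
      refine (add_le_add_right (norm_relativeCell_le hs i ξ x) 1).trans ?_
      have heq : geodesicDist ξ x / (c / (10 * b)) = 10 / c * (b * geodesicDist ξ x) := by
        field_simp
      have h₁ : 0 ≤ 10 / c := by positivity
      have h₂ : 0 ≤ b * geodesicDist ξ x := by positivity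
      rw [heq]
      linarith
    have hpow := Real.rpow_le_rpow (by positivity) hle (by linarith : 0 ≤ M)
    rw [Real.mul_rpow (by positivity) (by positivity)] at hpow
    rw [Real.rpow_neg (by positivity), ← div_eq_mul_inv, div_le_div_iff₀ (by positivity)
      (by positivity), one_mul]
    exact hpow
  refine (Finset.sum_le_sum hterm).trans ?_
  rw [← Finset.mul_sum]
  gcongr
  rw [← Finset.sum_image (f := fun m : Fin 2 → ℤ => (1 + ‖m‖) ^ (-M)) hinj]
  exact (summable_one_add_norm_rpow_neg hM).sum_le_tsum _ fun m _ => by positivity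

/-- `Z j` is the set of cubature points of scale `j`, with weights `w j`, exact up to degree `L j`
and forming a maximal `ε j`-mesh with `ε j ∼ B^{-j}`. The constant depends on
`B`, `M` and the two comparison constants in `ε j ∼ B^{-j}` only. -/
theorem lemma6 (B : ℝ) (hB : 1 < B) (c₁ c₂ : ℝ) (hc₁ : 0 < c₁) (hc₂ : 0 < c₂)
    (M : ℝ) (hM : 3 ≤ M) :
    ∃ C : ℝ, ∀ (L : ℕ → ℕ) (Z : ℕ → Finset UnitSphere) (w : ℕ → UnitSphere → ℝ) (ε : ℕ → ℝ),
      (∀ j, IsCubature (L j) (Z j) (w j)) →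
      (∀ j, IsMaximalMesh (ε j) (Z j : Set UnitSphere)) →
      (∀ j, c₁ / B ^ j ≤ ε j ∧ ε j ≤ c₂ / B ^ j) →
      ∀ j, ∀ ξ ∈ Z j, ∑ ξ' ∈ Z j, 1 / (1 + B ^ j * geodesicDist ξ ξ') ^ M ≤ C := by
  choose q hq using exists_half_le_unit_mul_coord
  refine ⟨∑ _p : Fin 3 × ℤˣ, (2 + 10 / c₁) ^ M * ∑' m : Fin 2 → ℤ, (1 + ‖m‖) ^ (-M), ?_⟩
  intro L Z w ε _ hZ hε j ξ _
  -- The six pieces overlap; the choice `q` assigns each point to just one.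
  rw [← Finset.sum_fiberwise (Z j) q]
  refine Finset.sum_le_sum fun p _ => ?_
  refine sum_le_tsum_of_isMesh (i := p.1) (u := p.2) (by linarith) (by positivity) hc₁ (hε j).1
    ((hZ j).prop.mono fun x hx => ?_) (fun x hx => ?_) ξ
  · exact (Finset.mem_filter.1 hx).1
  · rw [← (Finset.mem_filter.1 hx).2]
    exact hq x
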